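/- For non-negative integers $v,k,g,\lambda$, an $egr(v,k,g,\lambda)$-graph (edge-girth-regular graph) is a finite simple graph, not necessarily connected, with $v$ vertices that is $k$-regular, has girth $g$ (its shortest cycles have length $g$), and in which every edge is contained in exactly $\lambda$ cycles of length $g$, where cycles are counted as subgraphs. For every non-negative integer $v$, no $egr(v,4,5,8)$-graph exists and no $egr(v,6,5,24)$-graph exists. -/

import Mathlib

/-- The cycles of length `g` in `G` through the edge `e`, as subgraphs of `G`: a cycle is counted
once, whatever the starting point and the orientation of a closed walk that traverses it. -/
def cyclesThroughEdge {V : Type*} (G : SimpleGraph V) (g : ℕ) (e : Sym2 V) : Set G.Subgraph :=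
  {C | (∃ (x : V) (w : G.Walk x x), w.IsCycle ∧ w.length = g ∧ w.toSubgraph = C) ∧ e ∈ C.edgeSet}

/-- `G` is an edge-girth-regular `(v, k, g, lam)`-graph: a `k`-regular graph of girth `g` on `v`
vertices such that every edge is contained in exactly `lam` cycles of length `g`. -/
structure IsEdgeGirthRegular {V : Type*} [Fintype V] (G : SimpleGraph V) [DecidableRel G.Adj]
    (v k g lam : ℕ) : Prop where
  card_eq : Fintype.card V = v
  regular : G.IsRegularOfDegree k
  egirth_eq : G.egirth = (g : ℕ∞)
  ncard_cycles : ∀ e ∈ G.edgeSet, (cyclesThroughEdge G g e).ncard = lam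

/-! In both cases `λ = (k - 1)² - 1`. In girth 5 each of the `(k - 1)²` paths of length 3 with a
given middle edge lies in at most one pentagon, so exactly one of them is open
(`IsEdgeGirthRegular.isAlmostClosed`). Open paths can be continued, and for `k ≥ 3` all those
starting at `u` share one end, the antipode `σ u`. The component of `u` is then the ball of radius 2
around `u` together with `σ u`, so it has `k² + 2` vertices (`exists_antipodal_map`). With `A` the
adjacency matrix, `P` the matrix of `σ` and `J` the indicator of reachability, `A² + A + P = (k -
1)I + J`. Hence `X = (2A + I)(I - P)` satisfies `X² = 2(4k + 1)(I - P)`. Modulo a prime `p ∣ 4k +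
1`, `X` is nilpotent, so its trace on one component vanishes; but its diagonal is all ones, so this
trace is `k² + 2`. Thus `p ∣ k² + 2` (`false_of_dvd`), which fails for `k = 4`, `p = 17` and for `k
= 6`, `p = 5`. -/

/-- In a graph, `a, u, v, b` is a path whose ends have no common neighbour. -/
structure SimpleGraph.IsOpenPath {V : Type*} (G : SimpleGraph V) (a u v b : V) : Prop where
  adj₁ : G.Adj a u
  adj₂ : G.Adj u v
  adj₃ : G.Adj v b
  ne₁ : a ≠ v
  ne₂ : b ≠ u
  open_ends : ∀ x, G.Adj a x → ¬ G.Adj b x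

/-- A `k`-regular graph without cycles of length `3` and `4` in which every edge is the middle edge
of exactly one path of length `3` that does not extend to a cycle of length `5`. -/
structure SimpleGraph.IsAlmostClosed {V : Type*} [Fintype V] (G : SimpleGraph V)
    [DecidableRel G.Adj] (k : ℕ) : Prop where
  regular : G.IsRegularOfDegree k
  triangle_free : ∀ {a b c}, G.Adj a b → G.Adj b c → ¬ G.Adj a c
  common_unique : ∀ {a b x y}, a ≠ b → G.Adj a x → G.Adj b x → G.Adj a y → G.Adj b y → x = y
  exists_open : ∀ {u v}, G.Adj u v → ∃ a b, G.IsOpenPath a u v b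
  open_unique : ∀ {u v a b a' b'}, G.IsOpenPath a u v b → G.IsOpenPath a' u v b' → a = a' ∧ b = b'

/-! ### Open paths and antipodes. -/

namespace SimpleGraph

variable {V : Type*} {G : SimpleGraph V}

theorem IsOpenPath.symm {a u v b : V} (h : G.IsOpenPath a u v b) : G.IsOpenPath b v u a :=
  ⟨h.adj₃.symm, h.adj₂.symm, h.adj₁.symm, h.ne₂, h.ne₁, fun x hx hx' => h.open_ends x hx' hx⟩

namespace IsAlmostClosed

variable [Fintype V] [DecidableRel G.Adj] {k : ℕ} (hG : G.IsAlmostClosed k)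
include hG

/-- If every neighbour `c ≠ v` of `b` had a common neighbour with `u`, these would inject the `k -
1` vertices `c` into `N(u) \ {v}`. By counting, `a` would be hit, giving `a` and `b` a common
neighbour. -/
theorem exists_next {a u v b : V} (h : G.IsOpenPath a u v b) : ∃ w, G.IsOpenPath u v b w := by
  classical
  by_contra hcon
  push Not at hcon
  have hub : u ≠ b := h.ne₂.symm
  have key : ∀ c ∈ (G.neighborFinset b).erase v, ∃ x, G.Adj u x ∧ G.Adj c x := by
    intro c hc
    simp only [Finset.mem_erase, mem_neighborFinset] at hc
    by_contra hx
    push Not at hx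
    exact hcon c ⟨h.adj₂, h.adj₃, hc.2, hub, hc.1, hx⟩
  choose! f hf using key
  have hmaps : ∀ c ∈ (G.neighborFinset b).erase v, f c ∈ (G.neighborFinset u).erase v := by
    intro c hc
    have := hf c hc
    simp only [Finset.mem_erase, mem_neighborFinset] at hc ⊢
    refine ⟨fun e => ?_, this.1⟩
    rw [e] at this
    exact hG.triangle_free h.adj₃ hc.2 this.2.symm
  have hinj : Set.InjOn f ((G.neighborFinset b).erase v : Finset V) := by
    intro c hc c' hc' e
    have h1 := hf c hc
    have h2 := hf c' hc'
    rw [← e] at h2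
    simp only [Finset.coe_erase, Set.mem_sdiff, Finset.mem_coe, mem_neighborFinset] at hc hc'
    refine hG.common_unique (a := b) (b := f c) ?_ hc.1 h1.2.symm hc'.1 h2.2.symm
    intro e'
    rw [← e'] at h1
    exact hG.triangle_free h.adj₂ h.adj₃ h1.1
  have hcard : ((G.neighborFinset u).erase v).card ≤ ((G.neighborFinset b).erase v).card := by
    rw [Finset.card_erase_of_mem (by simpa using h.adj₂),
      Finset.card_erase_of_mem (by simpa using h.adj₃.symm), card_neighborFinset_eq_degree,
      card_neighborFinset_eq_degree, hG.regular u, hG.regular b]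
  have hsurj := Finset.surjOn_of_injOn_of_card_le f hmaps hinj hcard
  obtain ⟨c, hc, hca⟩ := hsurj (a := a) (by simpa using ⟨h.adj₁.symm, h.ne₁⟩)
  have h1 := hf c hc
  simp only [Finset.coe_erase, Set.mem_sdiff, Finset.mem_coe, mem_neighborFinset] at hc
  rw [hca] at h1
  exact h.open_ends c h1.2.symm hc.1

theorem exists_prev {u v b w : V} (h : G.IsOpenPath u v b w) : ∃ a, G.IsOpenPath a u v b := by
  obtain ⟨a, ha⟩ := hG.exists_next h.symm
  exact ⟨a, ha.symm⟩

theorem exists_open_of_adj {u v : V} (h : G.Adj u v) : ∃ b w, G.IsOpenPath u v b w := by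
  obtain ⟨a, b, hab⟩ := hG.exists_open h
  obtain ⟨w, hw⟩ := hG.exists_next hab
  exact ⟨b, w, hw⟩

/-- Extended backwards, both paths yield open paths with middle edge `uv`, and there is only one. -/
theorem eq_of_open {u v b w b' w' : V} (h : G.IsOpenPath u v b w) (h' : G.IsOpenPath u v b' w') :
    b = b' ∧ w = w' := by
  obtain ⟨a, ha⟩ := hG.exists_prev h
  obtain ⟨a', ha'⟩ := hG.exists_prev h'
  obtain ⟨-, rfl⟩ := hG.open_unique ha ha'
  exact ⟨rfl, (hG.open_unique h h').2⟩

theorem not_adj_of_open {u v b w : V} (h : G.IsOpenPath u v b w) : ¬ G.Adj u w := fun huw =>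
  h.ne₂ (hG.common_unique h.ne₁ h.adj₁ h.adj₂.symm huw h.adj₃).symm

theorem ne_of_open {u v b w : V} (h : G.IsOpenPath u v b w) : w ≠ u := by
  rintro rfl
  exact hG.triangle_free h.adj₁ h.adj₂ h.adj₃.symm

/-- All neighbours but one of the end of an open path have a common neighbour with its start. -/
theorem exists_common_of_open {u v b w c c₀ : V} (h : G.IsOpenPath u v b w)
    (h₀ : G.IsOpenPath v b w c₀) (hc : G.Adj w c) (hne : c ≠ c₀) :
    ∃ x, G.Adj u x ∧ G.Adj x c := by
  by_cases hcb : c = b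
  · exact ⟨v, h.adj₁, hcb ▸ h.adj₂⟩
  have h1 : ∃ x, G.Adj v x ∧ G.Adj c x := by
    by_contra hx
    push Not at hx
    exact hne (hG.eq_of_open ⟨h.adj₂, h.adj₃, hc, h.ne₂.symm, hcb, hx⟩ h₀).2
  obtain ⟨x, hvx, hcx⟩ := h1
  by_contra hcon
  push Not at hcon
  have hxb : x ≠ b := by
    rintro rfl
    exact hG.triangle_free h.adj₃ hc hcx.symm
  have hxu : x ≠ u := by
    rintro rfl
    exact h.open_ends c hcx.symm hc
  have hcv : c ≠ v := by
    rintro rfl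
    exact hG.triangle_free h.adj₂ h.adj₃ hc.symm
  -- A second open path beginning with `u, v`, against `eq_of_open`.
  have : G.IsOpenPath u v x c :=
    ⟨h.adj₁, hvx, hcx.symm, hxu.symm, hcv, fun y hy hy' => hcon y hy hy'.symm⟩
  exact hxb (hG.eq_of_open this h).1

theorem open_of_open {u v b w x c : V} (h : G.IsOpenPath u v b w) (hux : G.Adj u x)
    (hxc : G.Adj x c) (hcw : G.Adj c w) : G.IsOpenPath u x c w := by
  refine ⟨hux, hxc, hcw, ?_, ?_, h.open_ends⟩
  · rintro rfl
    exact hG.not_adj_of_open h hcw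
  · rintro rfl
    exact hG.not_adj_of_open h hux

/-- Each of the `k - 1` neighbours `c ≠ c₀` of `w` is the third vertex of an open path from `u` to
`w`. The second vertices are distinct, since there are no 4-cycles. -/
theorem le_card_fiber {u v b w : V} (h : G.IsOpenPath u v b w) (s : Finset V)
    (hs : ∀ x c, G.IsOpenPath u x c w → x ∈ s) : k - 1 ≤ s.card := by
  classical
  obtain ⟨c₀, h₀⟩ := hG.exists_next h
  have key : ∀ c ∈ (G.neighborFinset w).erase c₀, ∃ x, G.Adj u x ∧ G.Adj x c := by
    intro c hc
    simp only [Finset.mem_erase, mem_neighborFinset] at hc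
    exact hG.exists_common_of_open h h₀ hc.2 hc.1
  choose! f hf using key
  have hcard : ((G.neighborFinset w).erase c₀).card = k - 1 := by
    rw [Finset.card_erase_of_mem (by simpa using h₀.adj₃), card_neighborFinset_eq_degree,
      hG.regular w]
  rw [← hcard]
  refine Finset.card_le_card_of_injOn f ?_ ?_
  · intro c hc
    have h1 := hf c hc
    simp only [Finset.coe_erase, Set.mem_sdiff, Finset.mem_coe, mem_neighborFinset] at hc
    exact hs _ c (hG.open_of_open h h1.1 h1.2 hc.1.symm)
  · intro c hc c' hc' e
    have h1 := hf c hc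
    have h2 := hf c' hc'
    rw [← e] at h2
    simp only [Finset.coe_erase, Set.mem_sdiff, Finset.mem_coe, mem_neighborFinset] at hc hc'
    refine hG.common_unique (a := w) (b := f c) ?_ hc.1 h1.2 hc'.1 h2.2
    intro e'
    rw [← e'] at h1
    exact hG.not_adj_of_open h h1.1

/-- Distinct ends would claim disjoint sets of at least `k - 1` neighbours of `u`, but `2(k - 1) >
k`. -/
theorem end_eq_of_open (hk : 3 ≤ k) {u v b w v' b' w' : V} (h : G.IsOpenPath u v b w)
    (h' : G.IsOpenPath u v' b' w') : w = w' := by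
  classical
  by_contra hne
  let s (w : V) := (G.neighborFinset u).filter fun x => ∃ c, G.IsOpenPath u x c w
  have h1 := hG.le_card_fiber h (s w) fun x c hx => by
    simpa [s] using ⟨hx.adj₁, c, hx⟩
  have h2 := hG.le_card_fiber h' (s w') fun x c hx => by
    simpa [s] using ⟨hx.adj₁, c, hx⟩
  have hd : Disjoint (s w) (s w') := by
    rw [Finset.disjoint_left]
    intro x hx hx'
    simp only [s, Finset.mem_filter] at hx hx'
    obtain ⟨-, c, hc⟩ := hx
    obtain ⟨-, c', hc'⟩ := hx'
    exact hne (hG.eq_of_open hc hc').2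
  have h3 : (s w ∪ s w').card ≤ (G.neighborFinset u).card := Finset.card_le_card
    (Finset.union_subset (Finset.filter_subset _ _) (Finset.filter_subset _ _))
  rw [Finset.card_union_of_disjoint hd, card_neighborFinset_eq_degree, hG.regular u] at h3
  omega

theorem exists_antipode (hk : 3 ≤ k) (u : V) : ∃ w, ∀ v, G.Adj u v → ∃ b, G.IsOpenPath u v b w := by
  have hdeg : 0 < G.degree u := by rw [hG.regular u]; omega
  obtain ⟨v₀, hv₀⟩ := (G.degree_pos_iff_exists_adj u).1 hdeg
  obtain ⟨b₀, w, h₀⟩ := hG.exists_open_of_adj hv₀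
  refine ⟨w, fun v hv => ?_⟩
  obtain ⟨b, w', h⟩ := hG.exists_open_of_adj hv
  exact ⟨b, hG.end_eq_of_open hk h₀ h ▸ h⟩

/-- Each vertex `u` has an antipode; the ball of radius `2` around `u` and its antipode form the
connected component of `u`. -/
theorem exists_antipodal_map (hk : 3 ≤ k) : ∃ σ : V → V,
    (∀ u v, G.Adj u v → ∃ b, G.IsOpenPath u v b (σ u)) ∧ (∀ u, σ (σ u) = u) ∧
    (∀ u, σ u ≠ u) ∧ (∀ u, ¬ G.Adj u (σ u)) ∧ (∀ u x, G.Adj u x → ¬ G.Adj x (σ u)) ∧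
    (∀ u w, G.Reachable u w ↔ w = u ∨ G.Adj u w ∨ (∃ x, G.Adj u x ∧ G.Adj x w) ∨ w = σ u) := by
  classical
  choose σ hσ using hG.exists_antipode hk
  have hex : ∀ u, ∃ v b, G.IsOpenPath u v b (σ u) := fun u => by
    have hdeg : 0 < G.degree u := by rw [hG.regular u]; omega
    obtain ⟨v, hv⟩ := (G.degree_pos_iff_exists_adj u).1 hdeg
    obtain ⟨b, hb⟩ := hσ u v hv
    exact ⟨v, b, hb⟩
  -- The third vertices of the open paths from `u` to `σ u` are distinct, so they exhaust the `k`
  -- neighbours of `σ u`; no walk leaves the ball through the antipode.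
  have hback : ∀ u c, G.Adj (σ u) c → ∃ x, G.Adj u x ∧ G.Adj x c := by
    intro u c hc
    choose! f hf using hσ u
    have hinj : Set.InjOn f (G.neighborFinset u) := by
      intro v hv v' hv' e
      have h1 := hf v (by simpa using hv)
      have h2 := hf v' (by simpa using hv')
      rw [← e] at h2
      exact hG.common_unique h1.ne₁ h1.adj₁ h1.adj₂.symm h2.adj₁ h2.adj₂.symm
    obtain ⟨x, hx, rfl⟩ := Finset.surjOn_of_injOn_of_card_le f
      (t := G.neighborFinset (σ u))
      (fun v hv => by simpa using (hf v (by simpa using hv)).adj₃.symm) hinj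
      (by simp [hG.regular.degree_eq]) (a := c) (by simpa using hc)
    have h1 := hf x (by simpa using hx)
    exact ⟨x, h1.adj₁, h1.adj₂⟩
  refine ⟨σ, hσ, fun u => ?_, fun u => ?_, fun u => ?_, fun u x hx hx' => ?_, fun u w => ?_⟩
  · obtain ⟨v, b, h⟩ := hex u
    obtain ⟨b', h'⟩ := hσ (σ u) b h.adj₃.symm
    exact (hG.eq_of_open h.symm h').2.symm
  · obtain ⟨v, b, h⟩ := hex u
    exact hG.ne_of_open h
  · obtain ⟨v, b, h⟩ := hex u
    exact hG.not_adj_of_open h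
  · obtain ⟨v, b, h⟩ := hex u
    exact h.open_ends x hx hx'.symm
  constructor
  · rintro ⟨p⟩
    induction p using Walk.concatRec with
    | Hnil => exact Or.inl rfl
    | @Hconcat u w y p h ih =>
      rcases ih with rfl | h1 | ⟨x, h1, h2⟩ | rfl
      · exact Or.inr (Or.inl h)
      · exact Or.inr (Or.inr (Or.inl ⟨w, h1, h⟩))
      · by_cases hwu : w = u
        · subst hwu
          exact Or.inr (Or.inl h)
        by_cases hc : ∃ z, G.Adj u z ∧ G.Adj z y
        · exact Or.inr (Or.inr (Or.inl hc))
        by_cases hyx : y = x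
        · exact Or.inr (Or.inl (hyx ▸ h1))
        obtain ⟨b, hb⟩ := hσ u x h1
        have : G.IsOpenPath u x w y :=
          ⟨h1, h2, h, Ne.symm hwu, hyx, fun z hz hz' => hc ⟨z, hz, hz'.symm⟩⟩
        exact Or.inr (Or.inr (Or.inr (hG.eq_of_open this hb).2))
      · exact Or.inr (Or.inr (Or.inl (hback _ _ h)))
  · rintro (rfl | h | ⟨x, h1, h2⟩ | rfl)
    · exact Reachable.refl _
    · exact h.reachable
    · exact h1.reachable.trans h2.reachable
    · obtain ⟨v, b, h⟩ := hex u
      exact h.adj₁.reachable.trans (h.adj₂.reachable.trans h.adj₃.reachable)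

end IsAlmostClosed
end SimpleGraph

/-! ### The matrix equation and a trace modulo `p`. -/

open SimpleGraph Matrix

theorem SimpleGraph.IsAlmostClosed.false_of_dvd {V : Type*} [Fintype V] [Nonempty V]
    {G : SimpleGraph V} [DecidableRel G.Adj] {k : ℕ} (hG : G.IsAlmostClosed k) (hk : 3 ≤ k) (p : ℕ)
    [Fact p.Prime] (hp : p ∣ 4 * k + 1) (hp' : ¬ p ∣ k ^ 2 + 2) : False := by
  classical
  obtain ⟨σ, -, hσσ, hσ, hσ1, hσ2, hreach⟩ := hG.exists_antipodal_map hk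
  let A : Matrix V V (ZMod p) := G.adjMatrix (ZMod p)
  let P : Matrix V V (ZMod p) := Matrix.of fun u w => if σ u = w then 1 else 0
  let J : Matrix V V (ZMod p) := Matrix.of fun u w => if G.Reachable u w then 1 else 0
  have hσ_iff : ∀ u w, σ u = w ↔ u = σ w := fun u w =>
    ⟨fun h => by rw [← h, hσσ], fun h => by rw [h, hσσ]⟩
  have hreachσ : ∀ u, G.Reachable u (σ u) := fun u => (hreach u _).2 (by simp)
  have hPr : ∀ (M : Matrix V V (ZMod p)) u w, (M * P) u w = M u (σ w) := by
    intro M u w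
    simp [Matrix.mul_apply, P, hσ_iff]
  have hdeg : ∀ u, ((G.degree u : ℕ) : ZMod p) = k := fun u => by rw [hG.regular u]
  have hJA : J * A = (k : ZMod p) • J := by
    ext u w
    have : ∀ x ∈ G.neighborFinset w, J u x = J u w := by
      intro x hx
      have hx : G.Adj w x := by simpa using hx
      have : G.Reachable u x ↔ G.Reachable u w :=
        ⟨fun h => h.trans hx.symm.reachable, fun h => h.trans hx.reachable⟩
      simp [J, this]
    simp only [A, mul_adjMatrix_apply]
    rw [Finset.sum_congr rfl this]
    simp [hdeg]
  have hAJ : A * J = (k : ZMod p) • J := by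
    ext u w
    have : ∀ x ∈ G.neighborFinset u, J x w = J u w := by
      intro x hx
      have hx : G.Adj u x := by simpa using hx
      have : G.Reachable x w ↔ G.Reachable u w :=
        ⟨fun h => hx.reachable.trans h, fun h => hx.symm.reachable.trans h⟩
      simp [J, this]
    simp only [A, adjMatrix_mul_apply]
    rw [Finset.sum_congr rfl this]
    simp [hdeg]
  have hJP : J * P = J := by
    ext u w
    rw [hPr]
    have : G.Reachable u (σ w) ↔ G.Reachable u w :=
      ⟨fun h => h.trans (hreachσ w).symm, fun h => h.trans (hreachσ w)⟩
    simp [J, this]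
  have hPP : P * P = 1 := by
    ext u w
    rw [hPr]
    simp only [P, Matrix.of_apply, Matrix.one_apply]
    congr 1
    rw [hσ_iff, hσσ]
  -- Each vertex of the component of `u` is in exactly one of four positions: equal to `u`, adjacent
  -- to it, joined to it by a unique path of length 2, or its antipode.
  have hmain : A * A + A + P = ((k : ZMod p) - 1) • (1 : Matrix V V (ZMod p)) + J := by
    ext u w
    simp only [Matrix.add_apply, Matrix.smul_apply, smul_eq_mul]
    by_cases huw : w = u
    · subst huw
      have h1 : (A * A) w w = k := by
        simp only [A, adjMatrix_mul_self_apply_self, hdeg]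
      simp [h1, A, P, J, hσ]
    have h1 : (1 : Matrix V V (ZMod p)) u w = 0 := Matrix.one_apply_ne (Ne.symm huw)
    have hAA : (A * A) u w = if ∃ x, G.Adj u x ∧ G.Adj x w then 1 else 0 := by
      simp only [A, adjMatrix_mul_apply, adjMatrix_apply]
      split_ifs with hx
      · obtain ⟨x, hx1, hx2⟩ := hx
        rw [Finset.sum_eq_single x]
        · simp [hx2]
        · intro y hy hyx
          rw [if_neg]
          intro hyw
          exact hyx (hG.common_unique (Ne.symm huw) (by simpa using hy) hyw.symm hx1 hx2.symm)
        · intro h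
          exact absurd (by simpa using hx1) h
      · refine Finset.sum_eq_zero fun x hx' => if_neg fun h => hx ⟨x, by simpa using hx', h⟩
    rw [h1, hAA]
    simp only [A, P, J, adjMatrix_apply, Matrix.of_apply, hreach u w]
    by_cases ha : G.Adj u w
    · have hx : ¬ ∃ x, G.Adj u x ∧ G.Adj x w := fun ⟨x, hx, hx'⟩ => hG.triangle_free hx hx' ha
      have hs : ¬ σ u = w := fun h => hσ1 u (h ▸ ha)
      simp [ha, hx, hs]
    by_cases hx : ∃ x, G.Adj u x ∧ G.Adj x w
    · have hs : ¬ σ u = w := by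
        rintro rfl
        obtain ⟨x, hx1, hx2⟩ := hx
        exact hσ2 _ _ hx1 hx2
      simp [ha, hx, hs]
    · simp [ha, hx, huw, eq_comm]
  have hPeq : P = ((k : ZMod p) - 1) • (1 : Matrix V V (ZMod p)) + J - A * A - A := by
    rw [← hmain]; abel
  have hAP : A * P = P * A := by
    rw [hPeq]
    simp only [mul_sub, sub_mul, mul_add, add_mul, hAJ, hJA, mul_assoc]
    simp
  obtain ⟨u₀⟩ := ‹Nonempty V›
  -- Projection onto the component of `u₀`. Without it the trace would be `|V|`, which `p` may
  -- divide when there are several components.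
  let D : Matrix V V (ZMod p) := Matrix.diagonal fun u => if G.Reachable u₀ u then 1 else 0
  have hDcomm : ∀ M : Matrix V V (ZMod p), (∀ u w, M u w ≠ 0 → G.Reachable u w) → M * D = D * M := by
    intro M hM
    ext u w
    simp only [D, Matrix.mul_diagonal, Matrix.diagonal_mul]
    by_cases h0 : M u w = 0
    · simp [h0]
    have h := hM u w h0
    have : G.Reachable u₀ w ↔ G.Reachable u₀ u := ⟨fun h' => h'.trans h.symm, fun h' => h'.trans h⟩
    simp [this]
  have hAD : A * D = D * A := hDcomm A fun u w h => by
    by_cases ha : G.Adj u w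
    · exact ha.reachable
    · simp [A, ha] at h
  have hPD : P * D = D * P := hDcomm P fun u w h => by
    by_cases ha : σ u = w
    · exact ha ▸ hreachσ u
    · simp [P, ha] at h
  -- On the `-1` eigenspace of `P` the matrix `J` vanishes and `(2A + 1)² = 4k + 1`; the factor `1 -
  -- P` maps into that space.
  let X : Matrix V V (ZMod p) := (2 * A + 1) * (1 - P)
  have hXD : Commute X D := by
    have h1 : Commute A D := hAD
    have h2 : Commute P D := hPD
    exact (((Commute.ofNat_left 2 D).mul_left h1).add_left (Commute.one_left D)).mul_left
      ((Commute.one_left D).sub_left h2)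
  have hp0 : (4 * (k : ZMod p) + 1) = 0 := by
    have := (ZMod.natCast_eq_zero_iff (4 * k + 1) p).2 hp
    push_cast at this
    exact this
  have hXX : X * X = 0 := by
    have h1 : Commute (2 * A + 1) (1 - P) := by
      have h1 : Commute A P := hAP
      exact (Commute.one_right _).sub_right
        (((Commute.ofNat_left 2 P).mul_left h1).add_left (Commute.one_left P))
    have h2 : X * X = ((2 * A + 1) * (2 * A + 1)) * ((1 - P) * (1 - P)) := by
      show (2 * A + 1) * (1 - P) * ((2 * A + 1) * (1 - P)) = _
      rw [mul_assoc, ← mul_assoc (1 - P), ← h1.eq]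
      simp only [mul_assoc]
    have h3 : (1 - P) * (1 - P) = 2 * (1 - P) := by
      have : (1 - P) * (1 - P) = 1 - P - P + P * P := by noncomm_ring
      rw [this, hPP]; noncomm_ring
    have h4 : (2 * A + 1) * (2 * A + 1) = (4 * (k : ZMod p) - 3) • (1 : Matrix V V (ZMod p)) + 4 * J - 4 * P := by
      have : (2 * A + 1) * (2 * A + 1) = 4 * (A * A + A + P) + 1 - 4 * P := by noncomm_ring
      rw [this, hmain]
      have h4 : ∀ M : Matrix V V (ZMod p), 4 * M = (4 : ZMod p) • M := fun M => by
        rw [ofNat_smul_eq_nsmul, nsmul_eq_mul]; rfl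
      rw [h4, h4, h4]
      module
    have h5 : J * (1 - P) = 0 := by rw [mul_sub, hJP, mul_one, sub_self]
    have h6 : P * (1 - P) = -(1 - P) := by rw [mul_sub, hPP, mul_one]; abel
    have h7 : ((4 * (k : ZMod p) - 3) • (1 : Matrix V V (ZMod p)) + 4 * J - 4 * P) * (1 - P) = 0 := by
      rw [sub_mul, add_mul, mul_assoc, mul_assoc, h5, h6, smul_mul_assoc, one_mul]
      have : (4 * (k : ZMod p) - 3) = -4 := by linear_combination hp0
      rw [this, neg_smul, ofNat_smul_eq_nsmul]
      noncomm_ring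
    have h8 : (2 : Matrix V V (ZMod p)) * (1 - P) = (1 - P) * 2 := (Commute.ofNat_left 2 _).eq
    rw [h2, h3, h4, h8, ← mul_assoc, h7, zero_mul]
  have hnil : IsNilpotent (X * D) := hXD.isNilpotent_mul_right ⟨2, by rw [pow_two, hXX]⟩
  have htr := (Matrix.isNilpotent_trace_of_isNilpotent hnil).eq_zero
  have hdiag : ∀ u, (X * D) u u = J u₀ u := by
    intro u
    -- The diagonal entry of `A * P` is `A u (σ u)`, which is zero because antipodes are not
    -- adjacent.
    have hXu : X u u = 1 := by
      have h1 : X = A + A + 1 - (A * P + A * P) - P := by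
        simp only [X]; noncomm_ring
      have h2 : A u (σ u) = 0 := by simp [A, hσ1]
      have h3 : A u u = 0 := by simp [A]
      have h4 : P u u = 0 := by simp [P, hσ]
      simp [h1, hPr, h2, h3, h4]
    simp only [D, Matrix.mul_diagonal, hXu, J, Matrix.of_apply, one_mul]
  -- Applying `hmain` to the all-ones vector gives `k² + k + 1 = (k - 1) + ∑ u, J u₀ u`.
  have hsum : ∑ u, J u₀ u = (k : ZMod p) ^ 2 + 2 := by
    have h1 : A *ᵥ 1 = (k : ZMod p) • 1 := by
      ext u
      simp [A, hdeg]
    have h2 : P *ᵥ 1 = 1 := by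
      ext u
      simp [P, Matrix.mulVec, dotProduct]
    have h3 := congrFun (congrArg (· *ᵥ (1 : V → ZMod p)) hmain) u₀
    simp only [Matrix.add_mulVec, ← Matrix.mulVec_mulVec, h1, h2, Matrix.mulVec_smul,
      Matrix.smul_mulVec, Matrix.one_mulVec, Pi.add_apply, Pi.smul_apply, Pi.one_apply] at h3
    have h4 : (J *ᵥ 1) u₀ = ∑ u, J u₀ u := by simp [Matrix.mulVec, dotProduct]
    rw [h4] at h3
    simp only [smul_eq_mul, mul_one] at h3
    linear_combination -h3
  apply hp'
  rw [← ZMod.natCast_eq_zero_iff]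
  push_cast
  rw [← htr, ← hsum, Matrix.trace]
  exact Finset.sum_congr rfl fun u _ => (hdiag u).symm

/-! ### Pentagons through an edge. -/

namespace SimpleGraph

variable {V : Type*} {G : SimpleGraph V}

theorem not_adj_of_egirth (hg : 4 ≤ G.egirth) {a b c : V} (h₁ : G.Adj a b) (h₂ : G.Adj b c) :
    ¬ G.Adj a c := by
  intro h
  have hc : (Walk.cons h₁ (Walk.cons h₂ (Walk.cons h.symm Walk.nil))).IsCycle := by
    rw [Walk.cons_isCycle_iff]
    have := h₁.ne; have := h₂.ne; have := h.ne
    simp [Walk.cons_isPath_iff, *, Ne.symm]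
  have := hg.trans (egirth_le_length hc)
  simp at this
  norm_cast at this

theorem eq_of_common_adj_of_egirth (hg : 5 ≤ G.egirth) {a b x y : V} (hab : a ≠ b)
    (h₁ : G.Adj a x) (h₂ : G.Adj b x) (h₃ : G.Adj a y) (h₄ : G.Adj b y) : x = y := by
  by_contra hxy
  have hc : (Walk.cons h₁ (Walk.cons h₂.symm (Walk.cons h₄ (Walk.cons h₃.symm Walk.nil)))).IsCycle := by
    rw [Walk.cons_isCycle_iff]
    have := h₁.ne; have := h₂.ne; have := h₃.ne; have := h₄.ne
    simp [Walk.cons_isPath_iff, *, Ne.symm]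
  have := hg.trans (egirth_le_length hc)
  simp at this
  norm_cast at this

/-- The pentagon on the edges `au`, `uv`, `vb`, `bc`, `ca`, as a subgraph. -/
def pentagon (G : SimpleGraph V) (a u v b c : V) : G.Subgraph where
  verts := {a, u, v, b, c}
  -- The conjunct `G.Adj x y` yields a subgraph for arbitrary vertices, without adjacency
  -- hypotheses.
  Adj x y := G.Adj x y ∧
    (s(x, y) = s(u, v) ∨ s(x, y) = s(v, b) ∨ s(x, y) = s(b, c) ∨ s(x, y) = s(c, a) ∨
      s(x, y) = s(a, u))
  adj_sub h := h.1
  edge_vert := by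
    rintro x y ⟨-, h⟩
    simp only [Sym2.eq_iff] at h
    simp only [Set.mem_insert_iff, Set.mem_singleton_iff]
    tauto
  symm := ⟨by
    rintro x y ⟨h, h'⟩
    exact ⟨h.symm, by rwa [Sym2.eq_swap]⟩⟩

theorem toSubgraph_eq_pentagon {a u v b c : V} (h₁ : G.Adj u v) (h₂ : G.Adj v b) (h₃ : G.Adj b c)
    (h₄ : G.Adj c a) (h₅ : G.Adj a u) :
    (Walk.cons h₁ (.cons h₂ (.cons h₃ (.cons h₄ (.cons h₅ .nil))))).toSubgraph =
      G.pentagon a u v b c := by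
  ext x y
  · simp only [Walk.mem_verts_toSubgraph, pentagon]
    simp
    tauto
  · rw [Walk.adj_toSubgraph_iff_mem_edges]
    simp only [pentagon, Walk.edges_cons, Walk.edges_nil, List.mem_cons, List.not_mem_nil, or_false]
    refine ⟨fun h => ⟨?_, h⟩, fun h => h.2⟩
    rw [← mem_edgeSet]
    rcases h with h | h | h | h | h <;> rw [h] <;> assumption

/-- Serves the closed walks that traverse the edge from `v` to `u`. -/
theorem pentagon_reverse (a u v b c : V) : G.pentagon a u v b c = G.pentagon v u a c b := by
  ext x y
  · simp only [pentagon, Set.mem_insert_iff, Set.mem_singleton_iff]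
    tauto
  · simp only [pentagon]
    rw [Sym2.eq_swap (a := u) (b := a), Sym2.eq_swap (a := a) (b := c),
      Sym2.eq_swap (a := c) (b := b), Sym2.eq_swap (a := b) (b := v),
      Sym2.eq_swap (a := v) (b := u)]
    generalize s(x, y) = e
    refine and_congr_right fun _ => ?_
    constructor <;> rintro (h | h | h | h | h) <;> simp [h]

theorem isCycle_pentagon (hg : 4 ≤ G.egirth) {a u v b c : V} (h₁ : G.Adj u v) (h₂ : G.Adj v b)
    (h₃ : G.Adj b c) (h₄ : G.Adj c a) (h₅ : G.Adj a u) (hav : a ≠ v) (hbu : b ≠ u) :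
    (Walk.cons h₁ (.cons h₂ (.cons h₃ (.cons h₄ (.cons h₅ .nil))))).IsCycle := by
  have hcu : c ≠ u := by
    rintro rfl
    exact not_adj_of_egirth hg h₁ h₂ h₃.symm
  have hcv : c ≠ v := by
    rintro rfl
    exact not_adj_of_egirth hg h₁ h₄ h₅.symm
  have hab : a ≠ b := by
    rintro rfl
    exact not_adj_of_egirth hg h₁ h₂ h₅.symm
  have := h₁.ne; have := h₂.ne; have := h₃.ne; have := h₄.ne; have := h₅.ne
  rw [Walk.cons_isCycle_iff]
  simp [Walk.cons_isPath_iff]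
  grind

theorem exists_pentagon_of_isCycle {u v : V} (w : G.Walk u u) (hw : w.IsCycle) (hl : w.length = 5)
    (he : s(u, v) ∈ w.edges) : ∃ a b c, G.Adj u v ∧ G.Adj v b ∧ G.Adj b c ∧ G.Adj c a ∧
      G.Adj a u ∧ a ≠ v ∧ b ≠ u ∧ w.toSubgraph = G.pentagon a u v b c := by
  match w, hl with
  | .cons (v := x₁) h₁ (.cons (v := x₂) h₂ (.cons (v := x₃) h₃ (.cons (v := x₄) h₄
      (.cons h₅ .nil)))), _ =>
    rw [toSubgraph_eq_pentagon]
    have hn := hw.support_nodup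
    simp only [Walk.support_cons, Walk.support_nil, List.tail_cons, List.nodup_cons, List.mem_cons,
      List.not_mem_nil, or_false, not_or] at hn
    obtain ⟨⟨-, h13, h14, h1u⟩, ⟨-, h24, h2u⟩, ⟨-, h3u⟩, h4u, -⟩ := hn
    have hv : v = x₁ ∨ v = x₄ := by
      simp only [Walk.edges_cons, Walk.edges_nil, List.mem_cons, List.not_mem_nil, or_false,
        Sym2.eq_iff] at he
      clear hw
      rcases he with (h | h) | (h | h) | (h | h) | (h | h) | (h | h) <;> obtain ⟨e, e'⟩ := h
      · exact Or.inl e'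
      · exact absurd e.symm h1u
      · exact absurd e.symm h1u
      · exact absurd e.symm h2u
      · exact absurd e.symm h2u
      · exact absurd e.symm h3u
      · exact absurd e.symm h3u
      · exact absurd e.symm h4u
      · exact absurd e.symm h4u
      · exact Or.inr e'
    rcases hv with rfl | rfl
    · exact ⟨x₄, x₂, x₃, h₁, h₂, h₃, h₄, h₅, Ne.symm h14, h2u, rfl⟩
    · refine ⟨x₁, x₃, x₂, h₅.symm, h₄.symm, h₃.symm, h₂.symm, h₁.symm, h14, h3u, ?_⟩
      rw [pentagon_reverse]

end SimpleGraph

theorem mem_cyclesThroughEdge_five_iff {V : Type*} {G : SimpleGraph V} (hg : 4 ≤ G.egirth) {u v : V}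
    (C : G.Subgraph) : C ∈ cyclesThroughEdge G 5 s(u, v) ↔ ∃ a b c, G.Adj u v ∧ G.Adj v b ∧
      G.Adj b c ∧ G.Adj c a ∧ G.Adj a u ∧ a ≠ v ∧ b ≠ u ∧ C = G.pentagon a u v b c := by
  classical
  constructor
  · rintro ⟨⟨x, w, hw, hl, rfl⟩, he⟩
    rw [Walk.mem_edges_toSubgraph] at he
    have hu := w.fst_mem_support_of_mem_edges he
    rw [← w.toSubgraph_rotate hu]
    exact exists_pentagon_of_isCycle _ (hw.rotate hu) (by simpa using hl)
      ((w.rotate_edges u hu).mem_iff.2 he)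
  · rintro ⟨a, b, c, h₁, h₂, h₃, h₄, h₅, hav, hbu, rfl⟩
    exact ⟨⟨u, _, isCycle_pentagon hg h₁ h₂ h₃ h₄ h₅ hav hbu, rfl,
      toSubgraph_eq_pentagon h₁ h₂ h₃ h₄ h₅⟩, by simp [pentagon, h₁]⟩

theorem pentagon_inj {V : Type*} {G : SimpleGraph V} {a u v b c a' b' c' : V} (hau : G.Adj a u)
    (hvb : G.Adj v b) (hav : a ≠ v) (hbu : b ≠ u) (huv : u ≠ v)
    (h : G.pentagon a u v b c = G.pentagon a' u v b' c') (hcu : c' ≠ u) (hcv : c' ≠ v)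
    (hbu' : b' ≠ u) (hav' : a' ≠ v)
    (hau' : a' ≠ u) (hbv' : b' ≠ v) : a = a' ∧ b = b' := by
  have h1 : (G.pentagon a' u v b' c').Adj a u := h ▸ ⟨hau, by simp⟩
  have h2 : (G.pentagon a' u v b' c').Adj v b := h ▸ ⟨hvb, by simp⟩
  have h1 := h1.2
  have h2 := h2.2
  simp only [Sym2.eq_iff] at h1 h2
  refine ⟨?_, ?_⟩
  · clear h2
    grind
  · clear h1
    grind

/-- A pentagon through `uv` is determined by the neighbours `a` of `u` and `b` of `v` on it: the
fifth vertex is the only common neighbour of `a` and `b`, as there are no 4-cycles. -/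
theorem ncard_cyclesThroughEdge_five {V : Type*} [Fintype V] {G : SimpleGraph V}
    [DecidableRel G.Adj] [DecidableEq V] (hg : 5 ≤ G.egirth) {u v : V} (h : G.Adj u v) :
    (cyclesThroughEdge G 5 s(u, v)).ncard =
      ((((G.neighborFinset u).erase v) ×ˢ ((G.neighborFinset v).erase u)).filter
        fun p => ∃ c, G.Adj p.1 c ∧ G.Adj p.2 c).card := by
  have hg4 : 4 ≤ G.egirth := le_trans (by norm_num) hg
  set s := (((G.neighborFinset u).erase v) ×ˢ ((G.neighborFinset v).erase u)).filter
        fun p => ∃ c, G.Adj p.1 c ∧ G.Adj p.2 c with hs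
  have mem_s : ∀ p : V × V, p ∈ s ↔ ((p.1 ≠ v ∧ G.Adj u p.1) ∧ (p.2 ≠ u ∧ G.Adj v p.2)) ∧
      ∃ c, G.Adj p.1 c ∧ G.Adj p.2 c := by
    intro p
    simp [hs, Finset.mem_filter, Finset.mem_product]
  have hex : ∀ p ∈ s, ∃ c, G.Adj p.1 c ∧ G.Adj p.2 c := fun p hp => ((mem_s p).1 hp).2
  have : Nonempty V := ⟨u⟩
  choose! f hf using hex
  rw [← Set.ncard_coe_finset]
  symm
  refine Set.ncard_congr (fun p _ => G.pentagon p.1 u v p.2 (f p)) ?_ ?_ ?_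
  · intro p hp
    rw [Finset.mem_coe] at hp
    obtain ⟨⟨⟨h1, h2⟩, h3, h4⟩, -⟩ := (mem_s p).1 hp
    exact (mem_cyclesThroughEdge_five_iff hg4 _).2
      ⟨p.1, p.2, f p, h, h4, (hf p hp).2, (hf p hp).1.symm, h2.symm, h1, h3, rfl⟩
  · intro p q hp hq e
    rw [Finset.mem_coe] at hp hq
    obtain ⟨⟨⟨h1, h2⟩, h3, h4⟩, -⟩ := (mem_s p).1 hp
    obtain ⟨⟨⟨h1', h2'⟩, h3', h4'⟩, -⟩ := (mem_s q).1 hq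
    have := hf q hq
    have hcu : f q ≠ u := by
      intro e
      rw [e] at this
      exact not_adj_of_egirth hg4 h h4' this.2.symm
    have hcv : f q ≠ v := by
      intro e
      rw [e] at this
      exact not_adj_of_egirth hg4 h this.1.symm h2'
    obtain ⟨e1, e2⟩ := pentagon_inj h2.symm h4 h1 h3 h.ne e hcu hcv h3' h1' h2'.ne' h4'.ne'
    exact Prod.ext e1 e2
  · intro C hC
    obtain ⟨a, b, c, -, h₂, h₃, h₄, h₅, hav, hbu, rfl⟩ := (mem_cyclesThroughEdge_five_iff hg4 _).1 hC
    have hp : (a, b) ∈ s := (mem_s _).2 ⟨⟨⟨hav, h₅.symm⟩, hbu, h₂⟩, c, h₄.symm, h₃⟩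
    refine ⟨(a, b), hp, ?_⟩
    have := hf _ hp
    have hab : a ≠ b := by
      rintro rfl
      exact not_adj_of_egirth hg4 h h₂ h₅.symm
    have hc : f (a, b) = c :=
      eq_of_common_adj_of_egirth hg hab this.1 this.2 h₄.symm h₃
    simp only [hc]

theorem IsEdgeGirthRegular.isAlmostClosed {V : Type*} [Fintype V] {G : SimpleGraph V}
    [DecidableRel G.Adj] {v k : ℕ} (hk : 2 ≤ k)
    (h : IsEdgeGirthRegular G v k 5 ((k - 1) ^ 2 - 1)) : G.IsAlmostClosed k := by
  classical
  have hg : 5 ≤ G.egirth := h.egirth_eq.ge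
  have hg4 : 4 ≤ G.egirth := le_trans (by norm_num) hg
  have key : ∀ {u v}, G.Adj u v → ∃ p : V × V,
      ∀ a b, G.IsOpenPath a u v b ↔ (a, b) = p := by
    intro u v huv
    have h1 := h.ncard_cycles s(u, v) huv
    rw [ncard_cyclesThroughEdge_five hg huv] at h1
    have h2 := Finset.card_filter_add_card_filter_not (s := ((G.neighborFinset u).erase v) ×ˢ
      ((G.neighborFinset v).erase u)) (fun p => ∃ c, G.Adj p.1 c ∧ G.Adj p.2 c)
    rw [h1, Finset.card_product, Finset.card_erase_of_mem (by simpa using huv),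
      Finset.card_erase_of_mem (by simpa using huv.symm), G.card_neighborFinset_eq_degree,
      G.card_neighborFinset_eq_degree, h.regular u, h.regular v, ← pow_two] at h2
    have h3 : 0 < (k - 1) ^ 2 := Nat.pow_pos (by omega)
    have h4 : ∀ x, (k - 1) ^ 2 - 1 + x = (k - 1) ^ 2 → x = 1 := fun x hx => by omega
    obtain ⟨p, hp⟩ := Finset.card_eq_one.1 (h4 _ h2)
    refine ⟨p, fun a b => ?_⟩
    rw [← Finset.mem_singleton, ← hp]
    simp only [Finset.mem_filter, Finset.mem_product, Finset.mem_erase,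
      SimpleGraph.mem_neighborFinset]
    constructor
    · intro h
      exact ⟨⟨⟨h.ne₁, h.adj₁.symm⟩, h.ne₂, h.adj₃⟩, fun ⟨x, hx, hx'⟩ => h.open_ends x hx hx'⟩
    · rintro ⟨⟨⟨h1, h2⟩, h3, h4⟩, h5⟩
      exact ⟨h2.symm, huv, h4, h1, h3, fun x hx hx' => h5 ⟨x, hx, hx'⟩⟩
  refine ⟨h.regular, SimpleGraph.not_adj_of_egirth hg4,
    SimpleGraph.eq_of_common_adj_of_egirth hg, fun {u v} huv => ?_,
    fun {u v a b a' b'} h1 h2 => ?_⟩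
  · obtain ⟨⟨a, b⟩, hp⟩ := key huv
    exact ⟨a, b, (hp a b).2 rfl⟩
  · obtain ⟨p, hp⟩ := key h1.adj₂
    exact Prod.mk.inj (((hp a b).1 h1).trans ((hp a' b').1 h2).symm)

/-- The trace argument needs a vertex; the finite girth supplies one, an empty graph having girth
`⊤`. -/
theorem IsEdgeGirthRegular.nonempty {V : Type*} [Fintype V] {G : SimpleGraph V}
    [DecidableRel G.Adj] {v k g lam : ℕ} (h : IsEdgeGirthRegular G v k g lam) : Nonempty V := by
  by_contra hV
  rw [not_nonempty_iff] at hV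
  have : G.egirth = ⊤ := SimpleGraph.egirth_eq_top.2 fun x => isEmptyElim x
  rw [h.egirth_eq] at this
  exact ENat.natCast_ne_top g this

theorem mainTheorem4 :
    (∀ (v : ℕ) (V : Type*) [Fintype V] (G : SimpleGraph V) [DecidableRel G.Adj],
      ¬ IsEdgeGirthRegular G v 4 5 8) ∧
    (∀ (v : ℕ) (V : Type*) [Fintype V] (G : SimpleGraph V) [DecidableRel G.Adj],
      ¬ IsEdgeGirthRegular G v 6 5 24) := by
  refine ⟨fun v V _ G _ h => ?_, fun v V _ G _ h => ?_⟩
  · have := h.nonempty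
    -- `4 * 4 + 1 = 17`, while `4 ^ 2 + 2 = 18`.
    have : Fact (Nat.Prime 17) := ⟨by norm_num⟩
    exact (h.isAlmostClosed (k := 4) (by norm_num)).false_of_dvd (by norm_num) 17
      (by norm_num) (by norm_num)
  · have := h.nonempty
    -- `4 * 6 + 1 = 25`, while `6 ^ 2 + 2 = 38`.
    have : Fact (Nat.Prime 5) := ⟨by norm_num⟩
    exact (h.isAlmostClosed (k := 6) (by norm_num)).false_of_dvd (by norm_num) 5
      (by norm_num) (by norm_num)
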